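/- Let $n,\ell\ge 1$ and $m\ge 0$ be integers with $\ell\le n$, and let $X_1,\dots,X_n$ be random variables on a common probability space with values in a measurable space $\mathcal S$. Suppose that they admit a dependency graph of maximal degree at most $m$, i.e. a graph on $\{1,\dots,n\}$ of maximal degree at most $m$ such that, whenever $A,B\subset\{1,\dots,n\}$ are disjoint and no edge joins $A$ to $B$, the families $(X_k)_{k\in A}$ and $(X_k)_{k\in B}$ are independent. Let $\Lambda_{n,\ell}$ be the set of $\ell$-tuples $\alpha=(\alpha_1,\dots,\alpha_\ell)$ of pairwise distinct elements of $\{1,\dots,n\}$, and write $X_\alpha=(X_{\alpha_1},\dots,X_{\alpha_\ell})$. Let $f:\mathcal S^\ell\to\mathbb R$ be measurable and $(c_\alpha)_{\alpha\in\Lambda_{n,\ell}}$ an arbitrary family of real numbers such that $$L:=\max_{\alpha\in\Lambda_{n,\ell}}\|f(X_\alpha)-c_\alpha\|_\infty\in(0,\infty),$$ where $\|\cdot\|_\infty$ is the essential supremum norm. Put $$U_n=\frac{1}{\ell!\binom n\ell}\sum_{\alpha\in\Lambda_{n,\ell}}f(X_\alpha),\qquad V_n=\ell!\binom n\ell U_n,\qquad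 \Xi_\infty=\frac1L\sqrt{\frac{\operatorname{Var}[V_n]}{\ell^2(m+1)\,n^{2\ell-1}}},$$ and assume $\operatorname{Var}[U_n]\ne 0$. Then $\Xi_\infty\in(0,1]$ and $$\sup_{t\in\mathbb R}\left|\mathbb P\left(\frac{U_n-\mathbb E[U_n]}{\sqrt{\operatorname{Var}[U_n]}}\le t\right)-\frac1{\sqrt{2\pi}}\int_{-\infty}^t e^{-x^2/2}\,dx\right|\le 227.5\,\sqrt{\frac{\ell^2(m+1)}{n}}\;\Xi_\infty^{-3}.$$ -/

import Mathlib

open MeasureTheory ProbabilityTheory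
open scoped ENNReal

/-- The Kolmogorov distance `sup_t |μ((-∞, t]) - ν((-∞, t])|`. -/
noncomputable def kolmogorovDist (μ ν : Measure ℝ) : ℝ :=
  ⨆ t : ℝ, |μ.real (Set.Iic t) - ν.real (Set.Iic t)|

/-- `G` is a dependency graph of the family `(Y k)`: whenever `V₁` and `V₂` are disjoint sets of
vertices with no edge between them, the families `(Y k)_{k ∈ V₁}` and `(Y k)_{k ∈ V₂}` are
independent. -/
def IsDependencyGraph {V Ω S : Type*} [MeasurableSpace Ω] [MeasurableSpace S]
    (G : SimpleGraph V) (Y : V → Ω → S) (P : Measure Ω) : Prop :=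
  ∀ V₁ V₂ : Set V, Disjoint V₁ V₂ → (∀ i ∈ V₁, ∀ j ∈ V₂, ¬ G.Adj i j) →
    IndepFun (fun ω (i : V₁) => Y i ω) (fun ω (j : V₂) => Y j ω) P

/-- The set of `ℓ`-tuples of pairwise distinct indices among `n` indices. -/
abbrev DistinctTuple (n ℓ : ℕ) : Type := Fin ℓ ↪ Fin n

/-- The random variable `f(X_α) = f(X_{α₁}, …, X_{α_ℓ})`. -/
def kernelAt {Ω S : Type*} {n ℓ : ℕ} (f : (Fin ℓ → S) → ℝ) (X : Fin n → Ω → S)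
    (α : DistinctTuple n ℓ) : Ω → ℝ :=
  fun ω => f (fun i => X (α i) ω)

/-- The U-statistic `U_n`. -/
noncomputable def uStat {Ω S : Type*} {n ℓ : ℕ} (f : (Fin ℓ → S) → ℝ) (X : Fin n → Ω → S) :
    Ω → ℝ :=
  fun ω => 1 / ((ℓ.factorial : ℝ) * (n.choose ℓ : ℝ)) * ∑ α : DistinctTuple n ℓ, kernelAt f X α ω

/-- The non-normalized U-statistic `V_n = ℓ! (n choose ℓ) U_n`. -/
noncomputable def vStat {Ω S : Type*} {n ℓ : ℕ} (f : (Fin ℓ → S) → ℝ) (X : Fin n → Ω → S) :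
    Ω → ℝ :=
  fun ω => (ℓ.factorial : ℝ) * (n.choose ℓ : ℝ) * uStat f X ω

/-- `max_α ‖f(X_α) - c_α‖_∞`, an extended nonnegative real; norms are essential suprema. -/
noncomputable def kernelMaxNorm {Ω S : Type*} [MeasurableSpace Ω] {n ℓ : ℕ}
    (f : (Fin ℓ → S) → ℝ) (X : Fin n → Ω → S) (c : DistinctTuple n ℓ → ℝ) (P : Measure Ω) : ℝ≥0∞ :=
  ⨆ α : DistinctTuple n ℓ, eLpNorm (fun ω => kernelAt f X α ω - c α) ∞ P

/-- The renormalized standard deviation `Ξ_∞ = L⁻¹ √(Var V_n / (ℓ² (m + 1) n^(2ℓ - 1)))`. -/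
noncomputable def xiInfty {Ω S : Type*} [MeasurableSpace Ω] {n ℓ : ℕ}
    (f : (Fin ℓ → S) → ℝ) (X : Fin n → Ω → S) (m : ℕ) (L : ℝ) (P : Measure Ω) : ℝ :=
  1 / L * √(variance (vStat f X) P / ((ℓ : ℝ) ^ 2 * ((m : ℝ) + 1) * (n : ℝ) ^ (2 * ℓ - 1)))

/-!
The tuples `α` form the vertices of a dependency graph for the variables `f(X_α)`: two tuples are
adjacent when they share an index or when an edge of `G` joins an index of one to an index of the
other (`isDependencyGraph_tupleGraph`). It has at most `n ^ ℓ` vertices, and its closed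
neighbourhoods have at most `D = ℓ² (m + 1) n ^ (ℓ - 1)` elements
(`card_closedNbhd_tupleGraph_le`). Each of these variables is correlated with at most `D` others
and has variance at most `L²`, which bounds `Var V_n` by `n ^ ℓ D L²`, that is, `Ξ_∞ ≤ 1`.

The distance to the normal law is bounded for any normalised sum `W = ∑ ξ i` of `N` centred
variables with `|ξ i| ≤ B` and a dependency graph with closed neighbourhoods of size at most `D`:
it is at most `23.5 β`, where `β = N D² B³` (`kolmogorovDist_sum_le`). For the U-statistic
`B = 2 L / σ`, and the constant becomes `8 * 23.5 = 188 ≤ 227.5`.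

The general bound is proved by Stein's method. Half-line indicators are replaced by ramps of width
`ε`, for which the Stein equation `f' x - x f x = h x - E h(Z)` has a solution with `|f| ≤ 3` and
`|f'| ≤ 2` (`exists_stein_solution`). Let `S i` be the sum of the `ξ j` over the closed
neighbourhood of `i`. Since `ξ i` is independent of `W - S i`, one has
`E[W f(W)] = ∑ E[ξ i (f(W) - f(W - S i))]`, and expanding `f` to first order leaves two errors. The
first is at most `2 E|1 - T|` with `T = ∑ ξ i S i`; as `E T = 1`, it is controlled by `Var T`, a sum
over at most `4 N D³` pairs of linked pairs (`integral_abs_one_sub_linked_le`). The second is the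
Taylor remainder. It contains the term `(β / ε) P(W ∈ J)`, where `J` is the interval on which the
ramp decreases, enlarged by `D B`. Because the `ξ i` are bounded, `P(W ∈ J)` can be estimated by the
Gaussian measure of `J` plus twice the unknown distance `κ`. With `ε = 4 β` this yields
`κ ≤ C β + κ / 2`, which is solved for `κ`.
-/

/-! ### Gaussian tails and the Stein equation -/

lemma integrable_exp_neg_half_sq : Integrable fun y : ℝ => Real.exp (-(1 / 2) * y ^ 2) :=
  integrable_exp_neg_mul_sq (by norm_num)

lemma integral_Ioi_exp_neg_half_sq_le {x : ℝ} (hx : 0 ≤ x) :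
    ∫ y in Set.Ioi x, Real.exp (-(1 / 2) * y ^ 2) ≤ 3 * Real.exp (-(1 / 2) * x ^ 2) := by
  have hshift : Integrable fun y : ℝ => Real.exp (-(1 / 2) * (y - x) ^ 2) :=
    integrable_exp_neg_half_sq.comp_sub_right x
  calc ∫ y in Set.Ioi x, Real.exp (-(1 / 2) * y ^ 2)
      ≤ ∫ y in Set.Ioi x, Real.exp (-(1 / 2) * x ^ 2) * Real.exp (-(1 / 2) * (y - x) ^ 2) := by
        refine setIntegral_mono_on integrable_exp_neg_half_sq.integrableOn
          (hshift.const_mul _).integrableOn measurableSet_Ioi fun y hy => ?_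
        rw [← Real.exp_add]
        have : x < y := hy
        exact Real.exp_le_exp.2 (by nlinarith)
    _ ≤ ∫ y, Real.exp (-(1 / 2) * x ^ 2) * Real.exp (-(1 / 2) * (y - x) ^ 2) :=
        setIntegral_le_integral (hshift.const_mul _) (ae_of_all _ fun y => by positivity)
    _ = Real.exp (-(1 / 2) * x ^ 2) * √(Real.pi / (1 / 2)) := by
        rw [integral_const_mul, integral_sub_right_eq_self
          (fun y : ℝ => Real.exp (-(1 / 2) * y ^ 2)) x, integral_gaussian]
    _ ≤ 3 * Real.exp (-(1 / 2) * x ^ 2) := by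
        rw [mul_comm]
        refine mul_le_mul_of_nonneg_right ?_ (Real.exp_pos _).le
        rw [Real.sqrt_le_left (by norm_num)]
        linarith [Real.pi_le_four]

lemma mul_integral_Ioi_exp_neg_half_sq_le (x : ℝ) :
    x * ∫ y in Set.Ioi x, Real.exp (-(1 / 2) * y ^ 2) ≤ Real.exp (-(1 / 2) * x ^ 2) := by
  have hint : Integrable fun y : ℝ => y * Real.exp (-(1 / 2) * y ^ 2) :=
    integrable_mul_exp_neg_mul_sq (by norm_num)
  have hlim : Filter.Tendsto (fun y : ℝ => -Real.exp (-(1 / 2) * y ^ 2)) Filter.atTop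
      (nhds (-0)) := by
    refine (Real.tendsto_exp_atBot.comp ?_).neg
    exact (Filter.tendsto_pow_atTop two_ne_zero).const_mul_atTop_of_neg (by norm_num)
  have hval := integral_Ioi_of_hasDerivAt_of_tendsto' (a := x) (m := -0)
    (f := fun y : ℝ => -Real.exp (-(1 / 2) * y ^ 2))
    (f' := fun y => y * Real.exp (-(1 / 2) * y ^ 2)) (fun y _ => by
      refine (((hasDerivAt_pow 2 y).const_mul (-(1 / 2 : ℝ))).exp).neg.congr_deriv ?_
      simp only [Nat.cast_ofNat, Nat.add_one_sub_one, pow_one]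
      ring) hint.integrableOn hlim
  rw [← integral_const_mul]
  calc ∫ y in Set.Ioi x, x * Real.exp (-(1 / 2) * y ^ 2)
      ≤ ∫ y in Set.Ioi x, y * Real.exp (-(1 / 2) * y ^ 2) :=
        setIntegral_mono_on (integrable_exp_neg_half_sq.const_mul _).integrableOn
          hint.integrableOn measurableSet_Ioi fun y hy =>
            mul_le_mul_of_nonneg_right (le_of_lt hy) (Real.exp_pos _).le
    _ = Real.exp (-(1 / 2) * x ^ 2) := by rw [hval]; simp

/-- The two tail bounds behind the estimates for the Stein solution: a function dominated by the
Gaussian weight has, after division by the weight at `x ≥ 0`, a bounded tail integral, and this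
stays bounded when multiplied by `x`. -/
lemma tail_bounds_of_abs_le {k : ℝ → ℝ} (hk : Integrable k)
    (hle : ∀ y, |k y| ≤ Real.exp (-(1 / 2) * y ^ 2)) {x : ℝ} (hx : 0 ≤ x) :
    |Real.exp (1 / 2 * x ^ 2) * ∫ y in Set.Ioi x, k y| ≤ 3 ∧
    |x * (Real.exp (1 / 2 * x ^ 2) * ∫ y in Set.Ioi x, k y)| ≤ 1 := by
  have hI : |∫ y in Set.Ioi x, k y| ≤ ∫ y in Set.Ioi x, Real.exp (-(1 / 2) * y ^ 2) :=
    (abs_integral_le_integral_abs).trans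
      (setIntegral_mono_on hk.abs.integrableOn integrable_exp_neg_half_sq.integrableOn
        measurableSet_Ioi fun y _ => hle y)
  have hE : Real.exp (1 / 2 * x ^ 2) * Real.exp (-(1 / 2) * x ^ 2) = 1 := by
    rw [← Real.exp_add]; simp
  have hpos := Real.exp_pos (1 / 2 * x ^ 2)
  constructor
  · rw [abs_mul, abs_of_pos hpos]
    have := mul_le_mul_of_nonneg_left (hI.trans (integral_Ioi_exp_neg_half_sq_le hx)) hpos.le
    linarith
  · rw [abs_mul, abs_mul, abs_of_pos hpos, abs_of_nonneg hx]
    have h1 := mul_le_mul_of_nonneg_left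
      ((mul_le_mul_of_nonneg_left hI hx).trans (mul_integral_Ioi_exp_neg_half_sq_le x)) hpos.le
    linarith

/-- Bounded solution of the Stein equation `f' x - x f x = h x - E h(Z)` for a continuous `h` with
values in `[0, 1]`. -/
theorem exists_stein_solution {h : ℝ → ℝ} (hc : Continuous h) (h0 : ∀ x, 0 ≤ h x)
    (h1 : ∀ x, h x ≤ 1) :
    ∃ f : ℝ → ℝ, (∀ x, HasDerivAt f (x * f x + (h x - ∫ y, h y ∂gaussianReal 0 1)) x) ∧
      (∀ x, |f x| ≤ 3) ∧ ∀ x, |x * f x| ≤ 1 := by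
  set c := ∫ y, h y ∂gaussianReal 0 1 with hcdef
  have hhint : Integrable h (gaussianReal 0 1) :=
    Integrable.of_bound hc.aestronglyMeasurable 1
      (ae_of_all _ fun x => by rw [Real.norm_eq_abs, abs_of_nonneg (h0 x)]; exact h1 x)
  have hc0 : 0 ≤ c := integral_nonneg h0
  have hc1 : c ≤ 1 := by
    have := integral_mono hhint (integrable_const (1 : ℝ)) h1
    simpa using this
  set k : ℝ → ℝ := fun y => (h y - c) * Real.exp (-(1 / 2) * y ^ 2) with hk
  have hkc : Continuous k := by fun_prop
  have hle : ∀ y, |k y| ≤ Real.exp (-(1 / 2) * y ^ 2) := fun y => by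
    rw [hk]
    simp only
    rw [abs_mul, abs_of_pos (Real.exp_pos _)]
    refine mul_le_of_le_one_left (Real.exp_pos _).le (abs_le.2 ⟨?_, ?_⟩) <;>
      linarith [h0 y, h1 y]
  have hki : Integrable k :=
    integrable_exp_neg_half_sq.mono' hkc.aestronglyMeasurable (ae_of_all _ hle)
  -- The constant `c` is chosen so that `k` has total integral zero; this makes the left and the
  -- right tail integrals interchangeable.
  have hk0 : ∫ y, k y = 0 := by
    have e1 : ∫ y, (h y - c) ∂gaussianReal 0 1 = 0 := by
      rw [integral_sub hhint (integrable_const _)]; simp [hcdef]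
    rw [integral_gaussianReal_eq_integral_smul one_ne_zero] at e1
    have e2 : ∀ y, gaussianPDFReal 0 1 y • (h y - c) = (√(2 * Real.pi))⁻¹ * k y := fun y => by
      rw [gaussianPDFReal, hk]
      simp only [NNReal.coe_one, smul_eq_mul, sub_zero, mul_one]
      rw [show -y ^ 2 / 2 = -(1 / 2) * y ^ 2 by ring]
      ring
    simp_rw [e2] at e1
    rw [integral_const_mul] at e1
    exact (mul_eq_zero.1 e1).resolve_left (by positivity)
  have hsplit : ∀ x, ∫ y in Set.Iic x, k y = -∫ y in Set.Ioi x, k y := fun x => by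
    have := integral_add_compl (s := Set.Iic x) measurableSet_Iic hki
    rw [Set.compl_Iic, hk0] at this
    linarith
  have hb : ∀ x, |Real.exp (1 / 2 * x ^ 2) * ∫ y in Set.Iic x, k y| ≤ 3 ∧
      |x * (Real.exp (1 / 2 * x ^ 2) * ∫ y in Set.Iic x, k y)| ≤ 1 := fun x => by
    rcases le_total 0 x with hx | hx
    · have := tail_bounds_of_abs_le hki hle hx
      rw [hsplit]
      simpa only [mul_neg, abs_neg] using this
    · have := tail_bounds_of_abs_le (k := fun y => k (-y)) hki.comp_neg
        (fun y => by simpa using hle (-y)) (neg_nonneg.2 hx)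
      rw [integral_comp_neg_Ioi, neg_neg, neg_sq] at this
      simpa only [neg_mul, abs_neg] using this
  refine ⟨fun x => Real.exp (1 / 2 * x ^ 2) * ∫ y in Set.Iic x, k y, fun x => ?_,
    fun x => (hb x).1, fun x => (hb x).2⟩
  have hD : HasDerivAt (fun x => ∫ y in Set.Iic x, k y) (k x) x := by
    have e : (fun x => ∫ y in Set.Iic x, k y) =
        fun x => (∫ y in (0 : ℝ)..x, k y) + ∫ y in Set.Iic 0, k y := by
      funext x
      rw [← intervalIntegral.integral_Iic_sub_Iic hki.integrableOn hki.integrableOn]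
      ring
    rw [e]
    exact (hkc.integral_hasStrictDerivAt 0 x).hasDerivAt.add_const _
  have hexp := ((hasDerivAt_pow 2 x).const_mul (1 / 2 : ℝ)).exp
  refine (hexp.mul hD).congr_deriv ?_
  have hE : Real.exp (1 / 2 * x ^ 2) * Real.exp (-(1 / 2) * x ^ 2) = 1 := by
    rw [← Real.exp_add]; simp
  rw [hk]
  simp only [Nat.cast_ofNat, Nat.add_one_sub_one, pow_one]
  linear_combination (h x - c) * hE

/-- The continuous piecewise linear function equal to `1` on `(-∞, z]` and to `0` on
`[z + ε, ∞)`. -/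
noncomputable def ramp (z ε x : ℝ) : ℝ := max 0 (min 1 (1 - (x - z) / ε))

lemma continuous_ramp (z ε : ℝ) : Continuous (ramp z ε) := by
  unfold ramp; fun_prop

lemma ramp_nonneg (z ε x : ℝ) : 0 ≤ ramp z ε x := le_max_left _ _

lemma ramp_le_one (z ε x : ℝ) : ramp z ε x ≤ 1 := max_le zero_le_one (min_le_left _ _)

lemma ramp_of_le {z ε x : ℝ} (hε : 0 < ε) (hx : x ≤ z) : ramp z ε x = 1 := by
  have : (x - z) / ε ≤ 0 := div_nonpos_of_nonpos_of_nonneg (by linarith) hε.le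
  rw [ramp, min_eq_left (by linarith), max_eq_right zero_le_one]

lemma ramp_of_ge {z ε x : ℝ} (hε : 0 < ε) (hx : z + ε ≤ x) : ramp z ε x = 0 := by
  have : 1 ≤ (x - z) / ε := (one_le_div hε).2 (by linarith)
  rw [ramp, max_eq_left ((min_le_right _ _).trans (by linarith))]

lemma abs_ramp_sub_le {z ε : ℝ} (hε : 0 < ε) (x y : ℝ) :
    |ramp z ε x - ramp z ε y| ≤ |x - y| / ε := by
  unfold ramp
  refine (abs_max_sub_max_le_max _ _ _ _).trans ?_
  rw [sub_self, abs_zero, max_eq_right (abs_nonneg _)]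
  refine (abs_min_sub_min_le_max _ _ _ _).trans ?_
  rw [sub_self, abs_zero, max_eq_right (abs_nonneg _),
    show 1 - (x - z) / ε - (1 - (y - z) / ε) = (y - x) / ε by ring, abs_div, abs_of_pos hε,
    abs_sub_comm]

/-- The two values of the ramp agree unless both points are close to the interval where it
decreases. -/
lemma abs_ramp_sub_le_indicator {z ε M w u : ℝ} (hε : 0 < ε) (hu : |u - w| ≤ M) :
    |ramp z ε u - ramp z ε w| ≤ (Set.Ioc (z - M) (z + ε + M)).indicator (fun _ => M / ε) w := by
  rw [abs_le] at hu
  by_cases hw : w ∈ Set.Ioc (z - M) (z + ε + M)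
  · rw [Set.indicator_of_mem hw]
    exact (abs_ramp_sub_le hε u w).trans (div_le_div_of_nonneg_right (abs_le.2 hu) hε.le)
  · rw [Set.indicator_of_notMem hw]
    rcases le_or_gt w (z - M) with h | h
    · rw [ramp_of_le hε (by linarith : u ≤ z), ramp_of_le hε (by linarith : w ≤ z)]; simp
    · have h2 : z + ε + M < w := by
        by_contra! h3
        exact hw ⟨h, h3⟩
      rw [ramp_of_ge hε (by linarith : z + ε ≤ u), ramp_of_ge hε (by linarith : z + ε ≤ w)]; simp

/-- First order Taylor estimate for the Stein solution of a ramp function. -/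
lemma stein_taylor_bound {z ε : ℝ} (hε : 0 < ε) {f : ℝ → ℝ} {c : ℝ}
    (hf : ∀ x, HasDerivAt f (x * f x + (ramp z ε x - c)) x) (hf3 : ∀ x, |f x| ≤ 3)
    (hf2 : ∀ x, |x * f x + (ramp z ε x - c)| ≤ 2) {w s M : ℝ} (hs : |s| ≤ M) :
    |f w - f (w - s) - s * (w * f w + (ramp z ε w - c))| ≤
      M * (M * (3 + 2 * |w|) +
        (Set.Ioc (z - M) (z + ε + M)).indicator (fun _ => M / ε) w) := by
  have hM : 0 ≤ M := (abs_nonneg s).trans hs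
  set d := w * f w + (ramp z ε w - c) with hd
  set C := M * (3 + 2 * |w|) + (Set.Ioc (z - M) (z + ε + M)).indicator (fun _ => M / ε) w
  have hlip : ∀ x y, |f x - f y| ≤ 2 * |x - y| := fun x y => by
    have := convex_univ.norm_image_sub_le_of_norm_hasDerivWithin_le (C := 2)
      (fun x _ => (hf x).hasDerivWithinAt) (fun x _ => hf2 x) (Set.mem_univ y) (Set.mem_univ x)
    simpa only [Real.norm_eq_abs] using this
  have hderiv : ∀ u ∈ Set.uIcc (w - s) w, |u * f u + (ramp z ε u - c) - d| ≤ C := fun u hu => by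
    have huw : |u - w| ≤ M := by
      have h := Set.abs_sub_left_of_mem_uIcc (Set.uIcc_comm (w - s) w ▸ hu)
      rw [show w - s - w = -s by ring, abs_neg] at h
      exact h.trans hs
    have e : u * f u + (ramp z ε u - c) - d =
        (u - w) * f u + w * (f u - f w) + (ramp z ε u - ramp z ε w) := by rw [hd]; ring
    rw [e]
    have a1 : |(u - w) * f u| ≤ M * 3 := by
      rw [abs_mul]; exact mul_le_mul huw (hf3 u) (abs_nonneg _) hM
    have a2 : |w * (f u - f w)| ≤ |w| * (2 * M) := by
      rw [abs_mul]
      exact mul_le_mul_of_nonneg_left ((hlip u w).trans (by linarith)) (abs_nonneg _)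
    have a3 := abs_ramp_sub_le_indicator (z := z) hε huw
    have := abs_add_three ((u - w) * f u) (w * (f u - f w)) (ramp z ε u - ramp z ε w)
    have : M * (3 + 2 * |w|) = M * 3 + |w| * (2 * M) := by ring
    linarith
  have hC : 0 ≤ C := (abs_nonneg _).trans (hderiv w Set.right_mem_uIcc)
  have hmv := (convex_uIcc (w - s) w).norm_image_sub_le_of_norm_hasDerivWithin_le (C := C)
    (f := fun u => f u - u * d)
    (fun u _ => ((hf u).sub ((hasDerivAt_id u).mul_const d)).hasDerivWithinAt)
    (fun u hu => by simpa using hderiv u hu) Set.left_mem_uIcc Set.right_mem_uIcc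
  have e : f w - f (w - s) - s * d = f w - w * d - (f (w - s) - (w - s) * d) := by ring
  rw [e]
  refine hmv.trans ?_
  rw [show w - (w - s) = s by ring, Real.norm_eq_abs, mul_comm]
  exact mul_le_mul_of_nonneg_right hs hC

lemma gaussianReal_real_Ioc_le {a b : ℝ} (hab : a ≤ b) :
    (gaussianReal 0 1).real (Set.Ioc a b) ≤ (b - a) / 2 := by
  rw [measureReal_def, gaussianReal_apply_eq_integral _ one_ne_zero, ENNReal.toReal_ofReal
    (setIntegral_nonneg measurableSet_Ioc fun _ _ => gaussianPDFReal_nonneg _ _ _)]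
  have hp : ∀ x, gaussianPDFReal 0 1 x ≤ 1 / 2 := fun x => by
    rw [gaussianPDFReal]
    have h1 : Real.exp (-(x - 0) ^ 2 / (2 * ((1 : NNReal) : ℝ))) ≤ 1 :=
      Real.exp_le_one_iff.2 (by
        rw [neg_div]; simp only [Left.neg_nonpos_iff]; positivity)
    have h2 : 2 ≤ √(2 * Real.pi * ((1 : NNReal) : ℝ)) := by
      apply Real.le_sqrt_of_sq_le
      simp only [NNReal.coe_one]
      linarith [Real.pi_gt_three]
    have h3 : (√(2 * Real.pi * ((1 : NNReal) : ℝ)))⁻¹ ≤ 1 / 2 := by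
      rw [one_div]; exact inv_anti₀ (by norm_num) h2
    calc _ ≤ (1 / 2 : ℝ) * 1 := mul_le_mul h3 h1 (Real.exp_pos _).le (by norm_num)
      _ = 1 / 2 := by norm_num
  calc ∫ x in Set.Ioc a b, gaussianPDFReal 0 1 x ≤ ∫ _ in Set.Ioc a b, (1 / 2 : ℝ) :=
        setIntegral_mono (integrable_gaussianPDFReal 0 1).integrableOn
          (integrableOn_const (by simp)) hp
    _ = (b - a) / 2 := by
        rw [setIntegral_const, Real.volume_real_Ioc_of_le hab, smul_eq_mul]; ring

/-! ### Variances and moments of bounded variables -/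

section Variance

variable {Ω : Type*} [MeasurableSpace Ω] {P : Measure Ω} [IsProbabilityMeasure P]

lemma memLp_of_abs_sub_le {Z : Ω → ℝ} (hm : Measurable Z) {a C : ℝ}
    (hb : ∀ᵐ ω ∂P, |Z ω - a| ≤ C) (p : ℝ≥0∞) : MemLp Z p P := by
  refine MemLp.of_bound hm.aestronglyMeasurable (C + |a|) ?_
  filter_upwards [hb] with ω h
  have := abs_add_le (Z ω - a) a
  rw [sub_add_cancel] at this
  rw [Real.norm_eq_abs]
  linarith

lemma variance_le_sq_of_abs_sub_le {Z : Ω → ℝ} (hm : Measurable Z) {a C : ℝ}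
    (hb : ∀ᵐ ω ∂P, |Z ω - a| ≤ C) : variance Z P ≤ C ^ 2 := by
  have := variance_le_sq_of_bounded (μ := P) (X := Z) (a := a - C) (b := a + C)
    (by
      filter_upwards [hb] with ω h
      rw [abs_le] at h
      exact ⟨by linarith, by linarith⟩) hm.aemeasurable
  exact this.trans_eq (by ring)

/-- The variance of a sum of bounded variables, each correlated with at most `K` of them. -/
lemma variance_sum_le_of_card_correlated_le {κ : Type*} (s : Finset κ) (Z : κ → Ω → ℝ)
    (hm : ∀ p, Measurable (Z p)) (a : κ → ℝ) {C : ℝ}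
    (hb : ∀ p, ∀ᵐ ω ∂P, |Z p ω - a p| ≤ C) (r : κ → κ → Prop) [DecidableRel r]
    (h0 : ∀ p ∈ s, ∀ q ∈ s, ¬ r p q → covariance (Z p) (Z q) P = 0) {K : ℕ}
    (hK : ∀ p ∈ s, (s.filter (r p)).card ≤ K) :
    variance (fun ω => ∑ p ∈ s, Z p ω) P ≤ s.card * (K * C ^ 2) := by
  have hL2 : ∀ p, MemLp (Z p) 2 P := fun p => memLp_of_abs_sub_le (hm p) (hb p) 2
  have hcov : ∀ p q, covariance (Z p) (Z q) P ≤ C ^ 2 := fun p q => by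
    have h1 := variance_sub (hL2 p) (hL2 q)
    have h2 := variance_nonneg (Z p - Z q) P
    have h3 := variance_le_sq_of_abs_sub_le (hm p) (hb p)
    have h4 := variance_le_sq_of_abs_sub_le (hm q) (hb q)
    linarith
  rw [variance_fun_sum' fun p _ => hL2 p, ← nsmul_eq_mul]
  refine Finset.sum_le_card_nsmul _ _ _ fun p hp => ?_
  calc ∑ q ∈ s, covariance (Z p) (Z q) P
      = ∑ q ∈ s.filter (r p), covariance (Z p) (Z q) P := by
        rw [Finset.sum_filter]
        refine Finset.sum_congr rfl fun q hq => ?_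
        split_ifs with h
        · rfl
        · exact h0 p hp q hq h
    _ ≤ (s.filter (r p)).card • C ^ 2 := Finset.sum_le_card_nsmul _ _ _ fun q _ => hcov p q
    _ ≤ K * C ^ 2 := by
        rw [nsmul_eq_mul]
        exact mul_le_mul_of_nonneg_right (by exact_mod_cast hK p hp) (sq_nonneg C)

lemma integral_abs_le_of_integral_sq_le {Y : Ω → ℝ} (h1 : Integrable Y P)
    (h2 : Integrable (fun ω => Y ω ^ 2) P) {c : ℝ} (hc : 0 < c)
    (h : ∫ ω, Y ω ^ 2 ∂P ≤ c ^ 2) : ∫ ω, |Y ω| ∂P ≤ c := by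
  have hle : ∀ ω, |Y ω| ≤ (1 / (2 * c)) * Y ω ^ 2 + c / 2 := fun ω => by
    have : (1 / (2 * c)) * Y ω ^ 2 + c / 2 - |Y ω| = (|Y ω| - c) ^ 2 / (2 * c) := by
      rw [← sq_abs (Y ω)]; field_simp; ring
    have : 0 ≤ (|Y ω| - c) ^ 2 / (2 * c) := by positivity
    linarith
  calc ∫ ω, |Y ω| ∂P ≤ ∫ ω, ((1 / (2 * c)) * Y ω ^ 2 + c / 2) ∂P :=
        integral_mono h1.abs ((h2.const_mul _).add (integrable_const _)) hle
    _ = (1 / (2 * c)) * ∫ ω, Y ω ^ 2 ∂P + c / 2 := by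
        rw [integral_add (h2.const_mul _) (integrable_const _), integral_const_mul]; simp
    _ ≤ (1 / (2 * c)) * c ^ 2 + c / 2 := by gcongr
    _ = c := by field_simp; ring

end Variance

/-! ### Dependency graphs -/

section Dependency

variable {Ω ι : Type*} [MeasurableSpace Ω] {P : Measure Ω} [Fintype ι]

open Classical in
/-- The closed neighbourhood of `i` in `H`: the vertex `i` together with its neighbours. -/
noncomputable def closedNbhd (H : SimpleGraph ι) (i : ι) : Finset ι :=
  Finset.univ.filter fun j => j = i ∨ H.Adj i j

lemma mem_closedNbhd {H : SimpleGraph ι} {i j : ι} : j ∈ closedNbhd H i ↔ j = i ∨ H.Adj i j := by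
  simp [closedNbhd]

lemma mem_closedNbhd_comm {H : SimpleGraph ι} {i j : ι} :
    j ∈ closedNbhd H i ↔ i ∈ closedNbhd H j := by
  rw [mem_closedNbhd, mem_closedNbhd, H.adj_comm, eq_comm]

variable {H : SimpleGraph ι} {ξ : ι → Ω → ℝ}

/-- Functions of subfamilies of variables which are not linked are independent. -/
lemma IsDependencyGraph.indepFun_comp (hH : IsDependencyGraph H ξ P) (V₁ V₂ : Set ι)
    (h : ∀ i ∈ V₁, ∀ j ∈ V₂, j ∉ closedNbhd H i) {φ : (V₁ → ℝ) → ℝ} {ψ : (V₂ → ℝ) → ℝ}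
    (hφ : Measurable φ) (hψ : Measurable ψ) :
    IndepFun (fun ω => φ fun i => ξ i ω) (fun ω => ψ fun j => ξ j ω) P := by
  refine (hH V₁ V₂ ?_ ?_).comp hφ hψ
  · rw [Set.disjoint_left]
    exact fun i h1 h2 => h i h1 i h2 (mem_closedNbhd.2 (Or.inl rfl))
  · exact fun i h1 j h2 hij => h i h1 j h2 (mem_closedNbhd.2 (Or.inr hij))

open Classical in
lemma IsDependencyGraph.indepFun_sum_compl (hH : IsDependencyGraph H ξ P) (i : ι) :
    IndepFun (ξ i) (fun ω => ∑ j ∈ (closedNbhd H i)ᶜ, ξ j ω) P := by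
  have := hH.indepFun_comp {i} (↑(closedNbhd H i)ᶜ)
    (fun a ha j hj => by
      rw [Set.mem_singleton_iff.1 ha]
      simpa using hj)
    (φ := fun x => x ⟨i, rfl⟩) (ψ := fun x => ∑ j, x j) (by fun_prop) (by fun_prop)
  convert this using 2 with ω
  exact (Finset.sum_coe_sort (closedNbhd H i)ᶜ (fun j => ξ j ω)).symm

lemma IsDependencyGraph.indepFun_mul_mul (hH : IsDependencyGraph H ξ P) {i j k l : ι}
    (hik : k ∉ closedNbhd H i) (hjk : k ∉ closedNbhd H j) (hil : l ∉ closedNbhd H i)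
    (hjl : l ∉ closedNbhd H j) :
    IndepFun (fun ω => ξ i ω * ξ j ω) (fun ω => ξ k ω * ξ l ω) P :=
  hH.indepFun_comp {i, j} {k, l}
    (fun a ha b hb => by
      rcases ha with rfl | ha <;> rcases hb with rfl | hb
      · assumption
      · rwa [Set.mem_singleton_iff.1 hb]
      · rwa [Set.mem_singleton_iff.1 ha]
      · rwa [Set.mem_singleton_iff.1 ha, Set.mem_singleton_iff.1 hb])
    (φ := fun x => x ⟨i, by simp⟩ * x ⟨j, by simp⟩)
    (ψ := fun x => x ⟨k, by simp⟩ * x ⟨l, by simp⟩) (by fun_prop) (by fun_prop)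

open Classical in
/-- Call `(i, j)` a linked pair when `j` lies in the closed neighbourhood of `i`. At most `4 D ^ 2`
linked pairs `(k, l)` have a member in the closed neighbourhood of `i` or of `j`: there are four
cases, and in each of them one member has at most `D` values, and given it so has the other. -/
lemma card_linked_pairs_le {D : ℕ} (hD : ∀ i, (closedNbhd H i).card ≤ D) (i j : ι) :
    ((Finset.univ.sigma fun k => closedNbhd H k).filter fun q : Σ _ : ι, ι =>
      q.1 ∈ closedNbhd H i ∨ q.1 ∈ closedNbhd H j ∨
        q.2 ∈ closedNbhd H i ∨ q.2 ∈ closedNbhd H j).card ≤ 4 * D ^ 2 := by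
  have hfwd : ∀ i, ((Finset.univ.sigma fun k => closedNbhd H k).filter fun q : Σ _ : ι, ι =>
      q.1 ∈ closedNbhd H i).card ≤ D ^ 2 := fun i => by
    have : (Finset.univ.sigma fun k => closedNbhd H k).filter
        (fun q : Σ _ : ι, ι => q.1 ∈ closedNbhd H i) =
        (closedNbhd H i).sigma fun k => closedNbhd H k := by
      ext q; simp [and_comm]
    rw [this, Finset.card_sigma, sq]
    exact (Finset.sum_le_card_nsmul _ _ D fun k _ => hD k).trans
      (Nat.mul_le_mul_right D (hD i))
  have hbwd : ∀ i, ((Finset.univ.sigma fun k => closedNbhd H k).filter fun q : Σ _ : ι, ι =>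
      q.2 ∈ closedNbhd H i).card ≤ D ^ 2 := fun i => by
    refine le_trans (Finset.card_le_card_of_injOn (fun q => ⟨q.2, q.1⟩) (fun q hq => ?_) ?_)
      (hfwd i)
    · simp only [Finset.coe_filter, Finset.mem_sigma, Finset.mem_univ, true_and,
        Set.mem_ofPred_eq] at hq ⊢
      exact ⟨mem_closedNbhd_comm.1 hq.1, hq.2⟩
    · rintro ⟨a, b⟩ _ ⟨c, d⟩ _ h
      simp only [Sigma.mk.injEq, heq_eq_eq] at h ⊢
      exact ⟨h.2, h.1⟩
  rw [Finset.filter_or, Finset.filter_or, Finset.filter_or]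
  have u1 := Finset.card_union_le
    ((Finset.univ.sigma fun k => closedNbhd H k).filter fun q => q.1 ∈ closedNbhd H i)
    (((Finset.univ.sigma fun k => closedNbhd H k).filter fun q => q.1 ∈ closedNbhd H j) ∪
      (((Finset.univ.sigma fun k => closedNbhd H k).filter fun q => q.2 ∈ closedNbhd H i) ∪
      ((Finset.univ.sigma fun k => closedNbhd H k).filter fun q => q.2 ∈ closedNbhd H j)))
  have u2 := Finset.card_union_le
    ((Finset.univ.sigma fun k => closedNbhd H k).filter fun q => q.1 ∈ closedNbhd H j)
    (((Finset.univ.sigma fun k => closedNbhd H k).filter fun q => q.2 ∈ closedNbhd H i) ∪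
      ((Finset.univ.sigma fun k => closedNbhd H k).filter fun q => q.2 ∈ closedNbhd H j))
  have u3 := Finset.card_union_le
    ((Finset.univ.sigma fun k => closedNbhd H k).filter fun q => q.2 ∈ closedNbhd H i)
    ((Finset.univ.sigma fun k => closedNbhd H k).filter fun q => q.2 ∈ closedNbhd H j)
  have := hfwd i
  have := hfwd j
  have := hbwd i
  have := hbwd j
  omega

open Classical in
/-- Bound for the variance of `∑ ξ i ξ j`, over the pairs `(i, j)` with `j` in the closed
neighbourhood of `i`. There are at most `N D` of them, each correlated with at most `4 D ^ 2`. -/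
lemma variance_sum_linked_le [IsProbabilityMeasure P] (hH : IsDependencyGraph H ξ P)
    (hm : ∀ i, Measurable (ξ i)) {B : ℝ}
    (hB : ∀ i, ∀ᵐ ω ∂P, |ξ i ω| ≤ B) {D : ℕ} (hD : ∀ i, (closedNbhd H i).card ≤ D) :
    variance (fun ω => ∑ i, ξ i ω * ∑ j ∈ closedNbhd H i, ξ j ω) P ≤
      Fintype.card ι * D * (4 * D ^ 2 * B ^ 4) := by
  have hb : ∀ p : Σ _ : ι, ι, ∀ᵐ ω ∂P, |ξ p.1 ω * ξ p.2 ω - 0| ≤ B ^ 2 := fun p => by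
    filter_upwards [hB p.1, hB p.2] with ω h1 h2
    rw [sub_zero, abs_mul, sq]
    exact mul_le_mul h1 h2 (abs_nonneg _) ((abs_nonneg _).trans h1)
  have hmm : ∀ p : Σ _ : ι, ι, Measurable fun ω => ξ p.1 ω * ξ p.2 ω := fun p =>
    (hm _).mul (hm _)
  have key := variance_sum_le_of_card_correlated_le (P := P)
    (Finset.univ.sigma fun k => closedNbhd H k) (fun (p : Σ _ : ι, ι) ω => ξ p.1 ω * ξ p.2 ω)
    hmm (fun _ => 0) hb
    (fun p q => q.1 ∈ closedNbhd H p.1 ∨ q.1 ∈ closedNbhd H p.2 ∨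
        q.2 ∈ closedNbhd H p.1 ∨ q.2 ∈ closedNbhd H p.2)
    (fun p _ q _ h => by
      push Not at h
      exact (hH.indepFun_mul_mul h.1 h.2.1 h.2.2.1 h.2.2.2).covariance_eq_zero
        (memLp_of_abs_sub_le (hmm p) (hb p) 2) (memLp_of_abs_sub_le (hmm q) (hb q) 2))
    (fun p _ => by convert card_linked_pairs_le hD p.1 p.2)
  have e : (fun ω => ∑ i, ξ i ω * ∑ j ∈ closedNbhd H i, ξ j ω) = fun ω =>
      ∑ p ∈ Finset.univ.sigma fun k => closedNbhd H k, ξ p.1 ω * ξ p.2 ω := by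
    funext ω
    rw [Finset.sum_sigma]
    simp_rw [Finset.mul_sum]
  rw [e]
  refine key.trans ?_
  have hcard : (Finset.univ.sigma fun k => closedNbhd H k).card ≤ Fintype.card ι * D := by
    rw [Finset.card_sigma, ← smul_eq_mul, ← Finset.card_univ]
    exact Finset.sum_le_card_nsmul _ _ _ fun k _ => hD k
  have hcard' : ((Finset.univ.sigma fun k => closedNbhd H k).card : ℝ) ≤ Fintype.card ι * D := by
    exact_mod_cast hcard
  calc _ ≤ (Fintype.card ι * D : ℝ) * ((4 * D ^ 2 : ℕ) * (B ^ 2) ^ 2) :=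
        mul_le_mul_of_nonneg_right hcard' (by positivity)
    _ = _ := by push_cast; ring

open Classical in
lemma integral_mul_comp_sum_compl_eq_zero (hH : IsDependencyGraph H ξ P)
    (hm : ∀ i, Measurable (ξ i)) (h0 : ∀ i, ∫ ω, ξ i ω ∂P = 0) {g : ℝ → ℝ} (hg : Measurable g)
    (i : ι) : ∫ ω, ξ i ω * g (∑ j ∈ (closedNbhd H i)ᶜ, ξ j ω) ∂P = 0 := by
  have hmc : Measurable fun ω => ∑ j ∈ (closedNbhd H i)ᶜ, ξ j ω :=
    Finset.measurable_sum _ fun j _ => hm j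
  have hind : IndepFun (ξ i) (fun ω => g (∑ j ∈ (closedNbhd H i)ᶜ, ξ j ω)) P :=
    (hH.indepFun_sum_compl i).comp measurable_id hg
  rw [hind.integral_fun_mul_eq_mul_integral (hm i).aestronglyMeasurable
    (hg.comp hmc).aestronglyMeasurable, h0, zero_mul]

lemma abs_sum_closedNbhd_le {ι : Type*} [Fintype ι] {H : SimpleGraph ι} {B : ℝ} {D : ℕ}
    (hD : ∀ i, (closedNbhd H i).card ≤ D) {x : ι → ℝ} (hx : ∀ i, |x i| ≤ B) (i : ι) :
    |∑ j ∈ closedNbhd H i, x j| ≤ D * B := by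
  refine (Finset.abs_sum_le_sum_abs _ _).trans
    ((Finset.sum_le_card_nsmul _ _ B fun j _ => hx j).trans ?_)
  rw [nsmul_eq_mul]
  exact mul_le_mul_of_nonneg_right (by exact_mod_cast hD i) ((abs_nonneg _).trans (hx i))

lemma ae_abs_sum_mul_sum_le {B : ℝ} {D : ℕ} (hD : ∀ i, (closedNbhd H i).card ≤ D)
    (hB : ∀ i, ∀ᵐ ω ∂P, |ξ i ω| ≤ B) :
    ∀ᵐ ω ∂P, |∑ i, ξ i ω * ∑ j ∈ closedNbhd H i, ξ j ω| ≤ Fintype.card ι * (B * (D * B)) := by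
  filter_upwards [ae_all_iff.2 hB] with ω hω
  refine (Finset.abs_sum_le_sum_abs _ _).trans
    ((Finset.sum_le_card_nsmul _ _ (B * (D * B)) fun i _ => ?_).trans ?_)
  · rw [abs_mul]
    exact mul_le_mul (hω i) (abs_sum_closedNbhd_le hD hω i) (abs_nonneg _)
      ((abs_nonneg _).trans (hω i))
  · rw [nsmul_eq_mul, Finset.card_univ]

lemma ae_abs_sum_le {B : ℝ} (hB : ∀ i, ∀ᵐ ω ∂P, |ξ i ω| ≤ B) :
    ∀ᵐ ω ∂P, |∑ i, ξ i ω| ≤ Fintype.card ι * B := by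
  filter_upwards [ae_all_iff.2 hB] with ω hω
  refine (Finset.abs_sum_le_sum_abs _ _).trans
    ((Finset.sum_le_card_nsmul _ _ B fun i _ => hω i).trans ?_)
  rw [nsmul_eq_mul, Finset.card_univ]

open Classical in
lemma integral_sq_sum_eq_integral_sum_linked [IsProbabilityMeasure P]
    (hH : IsDependencyGraph H ξ P)
    (hm : ∀ i, Measurable (ξ i)) {B : ℝ} (hB : ∀ i, ∀ᵐ ω ∂P, |ξ i ω| ≤ B)
    (h0 : ∀ i, ∫ ω, ξ i ω ∂P = 0) :
    ∫ ω, (∑ i, ξ i ω) ^ 2 ∂P = ∫ ω, ∑ i, ξ i ω * ∑ j ∈ closedNbhd H i, ξ j ω ∂P := by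
  have hint : ∀ i j, Integrable (fun ω => ξ i ω * ξ j ω) P := fun i j =>
    Integrable.of_bound ((hm i).mul (hm j)).aestronglyMeasurable (B * B) (by
      filter_upwards [hB i, hB j] with ω h1 h2
      rw [Real.norm_eq_abs, abs_mul]
      exact mul_le_mul h1 h2 (abs_nonneg _) ((abs_nonneg _).trans h1))
  have hs : ∀ (i : ι) (s : Finset ι), Integrable (fun ω => ξ i ω * ∑ j ∈ s, ξ j ω) P :=
    fun i s => by
      simp_rw [Finset.mul_sum]
      exact integrable_finsetSum _ fun j _ => hint i j
  have e : ∀ ω, (∑ i, ξ i ω) ^ 2 = ∑ i, ξ i ω * (∑ j ∈ closedNbhd H i, ξ j ω) +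
      ∑ i, ξ i ω * ∑ j ∈ (closedNbhd H i)ᶜ, ξ j ω := fun ω => by
    rw [← Finset.sum_add_distrib, sq, Finset.sum_mul]
    exact Finset.sum_congr rfl fun i _ => by
      rw [← mul_add, Finset.sum_add_sum_compl]
  simp_rw [e]
  rw [integral_add (integrable_finsetSum _ fun i _ => hs i _)
    (integrable_finsetSum _ fun i _ => hs i _),
    integral_finsetSum (s := Finset.univ)
      (f := fun i ω => ξ i ω * ∑ j ∈ (closedNbhd H i)ᶜ, ξ j ω) fun i _ => hs i _,
    Finset.sum_eq_zero (f := fun i => ∫ ω, ξ i ω * ∑ j ∈ (closedNbhd H i)ᶜ, ξ j ω ∂P) fun i _ =>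
      integral_mul_comp_sum_compl_eq_zero hH hm h0 measurable_id i, add_zero]

end Dependency

/-! ### Berry–Esseen bound for sums over a dependency graph -/

section BerryEsseen

variable {Ω ι : Type*} [MeasurableSpace Ω] {P : Measure Ω} [IsProbabilityMeasure P] [Fintype ι]
  {H : SimpleGraph ι} {ξ : ι → Ω → ℝ} {B : ℝ} {D : ℕ}

/-- A normalised sum of bounded variables cannot have too few terms. -/
lemma one_le_card_mul (hH : IsDependencyGraph H ξ P) (hm : ∀ i, Measurable (ξ i))
    (hB : ∀ i, ∀ᵐ ω ∂P, |ξ i ω| ≤ B) (h0 : ∀ i, ∫ ω, ξ i ω ∂P = 0)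
    (hD : ∀ i, (closedNbhd H i).card ≤ D) (hW : ∫ ω, (∑ i, ξ i ω) ^ 2 ∂P = 1) :
    1 ≤ Fintype.card ι * (B * (D * B)) := by
  rw [← hW, integral_sq_sum_eq_integral_sum_linked hH hm hB h0]
  have hb := ae_abs_sum_mul_sum_le hD hB
  have hmT : Measurable fun ω => ∑ i, ξ i ω * ∑ j ∈ closedNbhd H i, ξ j ω := by fun_prop
  refine (integral_mono_ae (g := fun _ => Fintype.card ι * (B * (D * B)))
    (Integrable.of_bound hmT.aestronglyMeasurable _ hb) (integrable_const _) ?_).trans (by simp)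
  filter_upwards [hb] with ω h using (abs_le.1 h).2

/-- The variable `T = ∑ ξ i ξ j`, over the linked pairs `(i, j)`, has mean `1` and is concentrated
around it. -/
lemma integral_abs_one_sub_linked_le (hH : IsDependencyGraph H ξ P) (hm : ∀ i, Measurable (ξ i))
    (hB0 : 0 < B) (hB : ∀ i, ∀ᵐ ω ∂P, |ξ i ω| ≤ B) (h0 : ∀ i, ∫ ω, ξ i ω ∂P = 0)
    (hD : ∀ i, (closedNbhd H i).card ≤ D) (hW : ∫ ω, (∑ i, ξ i ω) ^ 2 ∂P = 1) :
    ∫ ω, |1 - ∑ i, ξ i ω * ∑ j ∈ closedNbhd H i, ξ j ω| ∂P ≤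
      2 * (Fintype.card ι * D ^ 2 * B ^ 3) := by
  set T : Ω → ℝ := fun ω => ∑ i, ξ i ω * ∑ j ∈ closedNbhd H i, ξ j ω with hT
  have h1 := one_le_card_mul hH hm hB h0 hD hW
  have hb := ae_abs_sum_mul_sum_le hD hB
  have hmT : Measurable T := by fun_prop
  have hL : MemLp T 2 P := MemLp.of_bound hmT.aestronglyMeasurable _ hb
  have hL' : MemLp (fun ω => 1 - T ω) 2 P := (memLp_const (1 : ℝ)).sub hL
  have hT1 : ∫ ω, T ω ∂P = 1 := by
    rw [hT, ← integral_sq_sum_eq_integral_sum_linked hH hm hB h0, hW]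
  have hN : (0 : ℝ) < Fintype.card ι ∧ (0 : ℝ) < D := by
    constructor
    · by_contra! hn
      have : (Fintype.card ι : ℝ) * (B * (D * B)) ≤ 0 :=
        mul_nonpos_of_nonpos_of_nonneg hn (by positivity)
      linarith
    · by_contra! hn
      have : (Fintype.card ι : ℝ) * (B * (D * B)) ≤ 0 := by
        have : (D : ℝ) * B ≤ 0 := mul_nonpos_of_nonpos_of_nonneg hn hB0.le
        exact mul_nonpos_of_nonneg_of_nonpos (by positivity)
          (mul_nonpos_of_nonneg_of_nonpos hB0.le this)
      linarith
  obtain ⟨hN0, hD0⟩ := hN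
  refine integral_abs_le_of_integral_sq_le (hL'.integrable (by norm_num)) hL'.integrable_sq
    (by positivity) ?_
  have hv := variance_sum_linked_le hH hm hB hD
  rw [variance_eq_integral hmT.aemeasurable, hT1] at hv
  calc ∫ ω, (1 - T ω) ^ 2 ∂P = ∫ ω, (T ω - 1) ^ 2 ∂P := by
        congr 1; funext ω; ring
    _ ≤ Fintype.card ι * D * (4 * D ^ 2 * B ^ 4) := hv
    _ = 4 * Fintype.card ι * D ^ 3 * B ^ 4 * 1 := by ring
    _ ≤ 4 * Fintype.card ι * D ^ 3 * B ^ 4 * (Fintype.card ι * (B * (D * B))) :=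
        mul_le_mul_of_nonneg_left h1 (by positivity)
    _ = (2 * (Fintype.card ι * D ^ 2 * B ^ 3)) ^ 2 := by ring

/-- Stein's method for a ramp function. Each `ξ i` is independent of the sum of the variables
outside its closed neighbourhood, so that `E[W f(W)]` is a sum of increments of `f`, which are
expanded to first order. The remainder is controlled by the probability that the sum falls close
to the interval where the ramp decreases. -/
lemma abs_integral_ramp_sub_le (hH : IsDependencyGraph H ξ P) (hm : ∀ i, Measurable (ξ i))
    (hB0 : 0 < B) (hB : ∀ i, ∀ᵐ ω ∂P, |ξ i ω| ≤ B) (h0 : ∀ i, ∫ ω, ξ i ω ∂P = 0)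
    (hD : ∀ i, (closedNbhd H i).card ≤ D) (hW : ∫ ω, (∑ i, ξ i ω) ^ 2 ∂P = 1)
    {z ε : ℝ} (hε : 0 < ε) :
    |∫ ω, ramp z ε (∑ i, ξ i ω) ∂P - ∫ y, ramp z ε y ∂gaussianReal 0 1| ≤
      (Fintype.card ι * D ^ 2 * B ^ 3) * (9 + (P.map fun ω => ∑ i, ξ i ω).real
        (Set.Ioc (z - D * B) (z + ε + D * B)) / ε) := by
  classical
  obtain ⟨f, hf, hf3, hxf⟩ :=
    exists_stein_solution (continuous_ramp z ε) (ramp_nonneg z ε) (ramp_le_one z ε)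
  set c := ∫ y, ramp z ε y ∂gaussianReal 0 1 with hc
  set N : ℝ := (Fintype.card ι : ℝ) with hNdef
  set W : Ω → ℝ := fun ω => ∑ i, ξ i ω with hWdef
  set S : ι → Ω → ℝ := fun i ω => ∑ j ∈ closedNbhd H i, ξ j ω with hS
  set R : ι → Ω → ℝ := fun i ω => ∑ j ∈ (closedNbhd H i)ᶜ, ξ j ω with hR
  set M : ℝ := D * B with hM
  have hM0 : 0 ≤ M := by positivity
  set J := Set.Ioc (z - M) (z + ε + M) with hJ
  have hc0 : 0 ≤ c := integral_nonneg (ramp_nonneg z ε)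
  have hc1 : c ≤ 1 := by
    have := integral_mono (μ := gaussianReal 0 1) (f := ramp z ε) (g := fun _ => (1 : ℝ))
      (Integrable.of_bound (continuous_ramp z ε).aestronglyMeasurable 1
        (ae_of_all _ fun x => by
          rw [Real.norm_eq_abs, abs_of_nonneg (ramp_nonneg z ε x)]; exact ramp_le_one z ε x))
      (integrable_const _) (ramp_le_one z ε)
    simpa using this
  have hf2 : ∀ x, |x * f x + (ramp z ε x - c)| ≤ 2 := fun x => by
    have h1 := abs_le.1 (hxf x)
    have := ramp_nonneg z ε x
    have := ramp_le_one z ε x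
    exact abs_le.2 ⟨by linarith, by linarith⟩
  have hfm : Measurable f :=
    (continuous_iff_continuousAt.2 fun x => (hf x).continuousAt).measurable
  have hrm : Measurable (ramp z ε) := (continuous_ramp z ε).measurable
  have hWm : Measurable W := by fun_prop
  have hSm : ∀ i, Measurable (S i) := fun i => by fun_prop
  have hRm : ∀ i, Measurable (R i) := fun i => by fun_prop
  have hWR : ∀ i ω, R i ω = W ω - S i ω := fun i ω => by
    rw [eq_sub_iff_add_eq, add_comm]
    exact Finset.sum_add_sum_compl _ _
  have hall := ae_all_iff.2 hB
  have hWL : MemLp W 2 P := MemLp.of_bound hWm.aestronglyMeasurable _ (ae_abs_sum_le hB)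
  have hWi : Integrable W P := hWL.integrable (by norm_num)
  have hW1 : ∫ ω, |W ω| ∂P ≤ 1 :=
    integral_abs_le_of_integral_sq_le hWi hWL.integrable_sq one_pos (by rw [hWdef, hW]; norm_num)
  have hTi : Integrable (fun ω => |1 - ∑ i, ξ i ω * S i ω|) P := by
    refine Integrable.abs ((integrable_const _).sub (Integrable.of_bound ?_ _
      (ae_abs_sum_mul_sum_le hD hB)))
    exact Measurable.aestronglyMeasurable (by fun_prop)
  have hξR : ∀ i, Integrable (fun ω => ξ i ω * f (R i ω)) P := fun i =>
    Integrable.of_bound ((hm i).mul (hfm.comp (hRm i))).aestronglyMeasurable (B * 3) (by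
      filter_upwards [hB i] with ω h
      rw [Real.norm_eq_abs, abs_mul]
      exact mul_le_mul h (hf3 _) (abs_nonneg _) hB0.le)
  have hri : Integrable (fun ω => ramp z ε (W ω)) P :=
    Integrable.of_bound (hrm.comp hWm).aestronglyMeasurable 1
      (ae_of_all _ fun ω => by
        rw [Real.norm_eq_abs, abs_of_nonneg (ramp_nonneg _ _ _)]; exact ramp_le_one _ _ _)
  have hri' : Integrable (fun ω => ramp z ε (W ω) - c) P := hri.sub (integrable_const c)
  -- The terms `ξ i * f (R i)` have mean zero and may be added freely.
  have hmain : ∫ ω, ramp z ε (W ω) ∂P - c =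
      ∫ ω, (ramp z ε (W ω) - c + ∑ i, ξ i ω * f (R i ω)) ∂P := by
    have hzero : ∫ ω, ∑ i, ξ i ω * f (R i ω) ∂P = 0 := by
      rw [integral_finsetSum _ fun i _ => hξR i]
      exact Finset.sum_eq_zero fun i _ => integral_mul_comp_sum_compl_eq_zero hH hm h0 hfm i
    rw [integral_add hri' (integrable_finsetSum _ fun i _ => hξR i),
      hzero, integral_sub hri (integrable_const c)]
    simp
  have hind : Integrable (fun ω => J.indicator (fun _ => M / ε) (W ω)) P :=
    Integrable.of_bound ((measurable_const.indicator measurableSet_Ioc).comp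
      hWm).aestronglyMeasurable (M / ε) (ae_of_all _ fun ω => by
        rw [Real.norm_eq_abs, abs_of_nonneg (Set.indicator_nonneg (fun _ _ => by positivity) _)]
        exact Set.indicator_le_self' (fun _ _ => by positivity) _)
  have hindval : ∫ ω, J.indicator (fun _ => M / ε) (W ω) ∂P = (P.map W).real J * (M / ε) := by
    rw [← integral_map (f := J.indicator fun _ => M / ε) hWm.aemeasurable
      (measurable_const.indicator measurableSet_Ioc).aestronglyMeasurable,
      integral_indicator measurableSet_Ioc, setIntegral_const, smul_eq_mul]
  have hbound : ∀ᵐ ω ∂P, |ramp z ε (W ω) - c + ∑ i, ξ i ω * f (R i ω)| ≤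
      2 * |1 - ∑ i, ξ i ω * S i ω| +
        N * (B * (M * (M * (3 + 2 * |W ω|) + J.indicator (fun _ => M / ε) (W ω)))) := by
    filter_upwards [hall] with ω hω
    set d := W ω * f (W ω) + (ramp z ε (W ω) - c) with hd
    have e : ramp z ε (W ω) - c + ∑ i, ξ i ω * f (R i ω) =
        d * (1 - ∑ i, ξ i ω * S i ω) -
          ∑ i, ξ i ω * (f (W ω) - f (W ω - S i ω) - S i ω * d) := by
      have e1 : ∑ i, ξ i ω * (f (W ω) - f (W ω - S i ω) - S i ω * d) =
          W ω * f (W ω) - ∑ i, ξ i ω * f (R i ω) - d * ∑ i, ξ i ω * S i ω := by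
        rw [hWdef, Finset.sum_mul, Finset.mul_sum, ← Finset.sum_sub_distrib,
          ← Finset.sum_sub_distrib]
        refine Finset.sum_congr rfl fun i _ => ?_
        rw [hWR]
        ring
      rw [e1, hd]
      ring
    rw [e]
    refine (abs_sub _ _).trans (add_le_add ?_ ?_)
    · rw [abs_mul]
      exact mul_le_mul_of_nonneg_right (hf2 _) (abs_nonneg _)
    · refine (Finset.abs_sum_le_sum_abs _ _).trans
        ((Finset.sum_le_card_nsmul _ _ _ fun i _ => ?_).trans_eq
          (by rw [nsmul_eq_mul, Finset.card_univ]))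
      rw [abs_mul]
      exact mul_le_mul (hω i)
        (stein_taylor_bound hε hf hf3 hf2 (abs_sum_closedNbhd_le hD hω i)) (abs_nonneg _) hB0.le
  have hi3 : Integrable (fun ω => 3 + 2 * |W ω|) P :=
    (integrable_const _).add (hWi.abs.const_mul 2)
  have hi2 : Integrable (fun ω => M * (3 + 2 * |W ω|) +
      J.indicator (fun _ => M / ε) (W ω)) P := (hi3.const_mul M).add hind
  rw [hmain]
  calc |∫ ω, (ramp z ε (W ω) - c + ∑ i, ξ i ω * f (R i ω)) ∂P|
      ≤ ∫ ω, |ramp z ε (W ω) - c + ∑ i, ξ i ω * f (R i ω)| ∂P := abs_integral_le_integral_abs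
    _ ≤ ∫ ω, (2 * |1 - ∑ i, ξ i ω * S i ω| + N * (B * (M * (M * (3 + 2 * |W ω|) +
          J.indicator (fun _ => M / ε) (W ω))))) ∂P :=
        integral_mono_ae (hri'.add
          (integrable_finsetSum _ fun i _ => hξR i)).abs
          ((hTi.const_mul 2).add (((hi2.const_mul M).const_mul B).const_mul N)) hbound
    _ = 2 * ∫ ω, |1 - ∑ i, ξ i ω * S i ω| ∂P + N * (B * (M * (M * (3 + 2 * ∫ ω, |W ω| ∂P) +
          (P.map W).real J * (M / ε)))) := by
        rw [integral_add (hTi.const_mul 2) (((hi2.const_mul M).const_mul B).const_mul N),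
          integral_const_mul, integral_const_mul, integral_const_mul, integral_const_mul,
          integral_add (hi3.const_mul M) hind, integral_const_mul,
          integral_add (integrable_const _) (hWi.abs.const_mul 2), integral_const_mul, hindval]
        simp
    _ ≤ 2 * (2 * (N * D ^ 2 * B ^ 3)) + N * (B * (M * (M * (3 + 2 * 1) +
          (P.map W).real J * (M / ε)))) := by
        have := integral_abs_one_sub_linked_le hH hm hB0 hB h0 hD hW
        gcongr
    _ = (N * D ^ 2 * B ^ 3) * (9 + (P.map W).real J / ε) := by
        rw [hM]; ring

lemma bddAbove_kolmogorovDist (μ ν : Measure ℝ) [IsProbabilityMeasure μ]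
    [IsProbabilityMeasure ν] :
    BddAbove (Set.range fun t : ℝ => |μ.real (Set.Iic t) - ν.real (Set.Iic t)|) := by
  refine ⟨1, ?_⟩
  rintro _ ⟨t, rfl⟩
  have := measureReal_nonneg (μ := μ) (s := Set.Iic t)
  have := measureReal_nonneg (μ := ν) (s := Set.Iic t)
  have := measureReal_le_one (μ := μ) (s := Set.Iic t)
  have := measureReal_le_one (μ := ν) (s := Set.Iic t)
  exact abs_le.2 ⟨by linarith, by linarith⟩

lemma abs_sub_le_kolmogorovDist (μ ν : Measure ℝ) [IsProbabilityMeasure μ]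
    [IsProbabilityMeasure ν] (t : ℝ) :
    |μ.real (Set.Iic t) - ν.real (Set.Iic t)| ≤ kolmogorovDist μ ν :=
  le_ciSup (bddAbove_kolmogorovDist μ ν) t

lemma measureReal_Ioc_eq_sub (μ : Measure ℝ) [IsProbabilityMeasure μ] {a b : ℝ} (hab : a ≤ b) :
    μ.real (Set.Ioc a b) = μ.real (Set.Iic b) - μ.real (Set.Iic a) := by
  rw [← Set.Iic_sdiff_Iic, measureReal_sdiff (Set.Iic_subset_Iic.2 hab) measurableSet_Iic]

lemma measureReal_Iic_le_integral_ramp (μ : Measure ℝ) [IsProbabilityMeasure μ] {z ε : ℝ}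
    (hε : 0 < ε) :
    μ.real (Set.Iic z) ≤ ∫ y, ramp z ε y ∂μ ∧ ∫ y, ramp z ε y ∂μ ≤ μ.real (Set.Iic (z + ε)) := by
  have hi : Integrable (ramp z ε) μ :=
    Integrable.of_bound (continuous_ramp z ε).aestronglyMeasurable 1 (ae_of_all _ fun x => by
      rw [Real.norm_eq_abs, abs_of_nonneg (ramp_nonneg _ _ _)]; exact ramp_le_one _ _ _)
  have hind : ∀ t : ℝ, Integrable ((Set.Iic t).indicator fun _ => (1 : ℝ)) μ := fun t =>
    (integrable_const _).indicator measurableSet_Iic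
  have hval : ∀ t : ℝ, ∫ y, (Set.Iic t).indicator (fun _ => (1 : ℝ)) y ∂μ = μ.real (Set.Iic t) :=
    fun t => by rw [integral_indicator measurableSet_Iic, setIntegral_const]; simp
  rw [← hval, ← hval]
  constructor
  · refine integral_mono (hind _) hi fun x => ?_
    by_cases hx : x ∈ Set.Iic z
    · rw [Set.indicator_of_mem hx, ramp_of_le hε hx]
    · rw [Set.indicator_of_notMem hx]; exact ramp_nonneg _ _ _
  · refine integral_mono hi (hind _) fun x => ?_
    by_cases hx : x ∈ Set.Iic (z + ε)
    · rw [Set.indicator_of_mem hx]; exact ramp_le_one _ _ _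
    · rw [Set.indicator_of_notMem hx, ramp_of_ge hε (le_of_lt (not_le.1 hx))]

/-- Berry–Esseen bound for the normalised sum of centred variables bounded by `B` with a dependency
graph whose closed neighbourhoods have at most `D` elements. -/
theorem kolmogorovDist_sum_le (hH : IsDependencyGraph H ξ P) (hm : ∀ i, Measurable (ξ i))
    (hB0 : 0 < B) (hB : ∀ i, ∀ᵐ ω ∂P, |ξ i ω| ≤ B) (h0 : ∀ i, ∫ ω, ξ i ω ∂P = 0)
    (hD : ∀ i, (closedNbhd H i).card ≤ D) (hW : ∫ ω, (∑ i, ξ i ω) ^ 2 ∂P = 1) :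
    kolmogorovDist (P.map fun ω => ∑ i, ξ i ω) (gaussianReal 0 1) ≤
      47 / 2 * (Fintype.card ι * D ^ 2 * B ^ 3) := by
  have hWm : Measurable fun ω => ∑ i, ξ i ω := by fun_prop
  set μ := P.map fun ω => ∑ i, ξ i ω with hμ
  have : IsProbabilityMeasure μ := Measure.isProbabilityMeasure_map hWm.aemeasurable
  set γ := gaussianReal 0 1
  set κ := kolmogorovDist μ γ with hκ
  set β : ℝ := Fintype.card ι * D ^ 2 * B ^ 3 with hβ
  have h1 := one_le_card_mul hH hm hB h0 hD hW
  have hDB : (D : ℝ) * B ≤ β := by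
    calc (D : ℝ) * B = D * B * 1 := by ring
      _ ≤ D * B * (Fintype.card ι * (B * (D * B))) :=
          mul_le_mul_of_nonneg_left h1 (by positivity)
      _ = β := by rw [hβ]; ring
  have hDB0 : 0 ≤ (D : ℝ) * B := by positivity
  have hβ0 : 0 < β := by
    refine lt_of_le_of_ne (by positivity) fun h => ?_
    have hz : (D : ℝ) * B = 0 := le_antisymm (hDB.trans h.ge) hDB0
    rw [hz, mul_zero, mul_zero] at h1
    linarith
  -- The width of the smoothing window: the factor 4 makes the coefficient of `κ` on the right-hand
  -- side equal to `1 / 2`.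
  have hε : 0 < 4 * β := by positivity
  have hsmooth : ∀ z, |∫ y, ramp z (4 * β) y ∂μ - ∫ y, ramp z (4 * β) y ∂γ| ≤
      39 / 4 * β + κ / 2 := fun z => by
    have hs := abs_integral_ramp_sub_le hH hm hB0 hB h0 hD hW (z := z) hε
    rw [← integral_map (f := ramp z (4 * β)) hWm.aemeasurable
      (continuous_ramp _ _).aestronglyMeasurable] at hs
    refine hs.trans ?_
    have hp : μ.real (Set.Ioc (z - D * B) (z + 4 * β + D * B)) ≤ 3 * β + 2 * κ := by
      have hle : z - D * B ≤ z + 4 * β + D * B := by linarith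
      have a1 := measureReal_Ioc_eq_sub μ hle
      have a2 := measureReal_Ioc_eq_sub γ hle
      have a3 := gaussianReal_real_Ioc_le hle
      have a4 := abs_le.1 (abs_sub_le_kolmogorovDist μ γ (z - D * B))
      have a5 := abs_le.1 (abs_sub_le_kolmogorovDist μ γ (z + 4 * β + D * B))
      linarith
    calc β * (9 + μ.real (Set.Ioc (z - D * B) (z + 4 * β + D * B)) / (4 * β))
        ≤ β * (9 + (3 * β + 2 * κ) / (4 * β)) := by gcongr
      _ = 39 / 4 * β + κ / 2 := by field_simp; ring
  have hfin : κ ≤ 47 / 4 * β + κ / 2 := by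
    refine ciSup_le fun t => ?_
    have hg : ∀ a, γ.real (Set.Iic (a + 4 * β)) - γ.real (Set.Iic a) ≤ 2 * β := fun a => by
      rw [← measureReal_Ioc_eq_sub γ (by linarith : a ≤ a + 4 * β)]
      exact (gaussianReal_real_Ioc_le (by linarith)).trans_eq (by ring)
    refine abs_le.2 ⟨?_, ?_⟩
    · have b1 := (measureReal_Iic_le_integral_ramp μ (z := t - 4 * β) hε).2
      have b2 := (measureReal_Iic_le_integral_ramp γ (z := t - 4 * β) hε).1
      have b3 := abs_le.1 (hsmooth (t - 4 * β))
      have b4 := hg (t - 4 * β)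
      rw [sub_add_cancel] at b1 b4
      linarith
    · have b1 := (measureReal_Iic_le_integral_ramp μ (z := t) hε).1
      have b2 := (measureReal_Iic_le_integral_ramp γ (z := t) hε).2
      have b3 := abs_le.1 (hsmooth t)
      have b4 := hg t
      linarith
  linarith

end BerryEsseen

/-! ### The dependency graph of a U-statistic -/

section Tuples

variable {n ℓ : ℕ}

/-- Two distinct tuples are adjacent when they share an index or when some edge of `G` joins an
index of the first to an index of the second. -/
def tupleGraph (ℓ : ℕ) (G : SimpleGraph (Fin n)) : SimpleGraph (DistinctTuple n ℓ) where
  Adj α β := α ≠ β ∧ ∃ i j, α i = β j ∨ G.Adj (α i) (β j)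
  symm := ⟨fun _ _ h => by
    obtain ⟨hne, i, j, hij⟩ := h
    exact ⟨hne.symm, j, i, hij.imp Eq.symm fun h => h.symm⟩⟩
  loopless := ⟨fun _ h => h.1 rfl⟩

lemma isDependencyGraph_tupleGraph {Ω S : Type*} [MeasurableSpace Ω] [MeasurableSpace S]
    {P : Measure Ω} {X : Fin n → Ω → S} {G : SimpleGraph (Fin n)} (hG : IsDependencyGraph G X P)
    {f : (Fin ℓ → S) → ℝ} (hf : Measurable f) {g : DistinctTuple n ℓ → ℝ → ℝ}
    (hg : ∀ α, Measurable (g α)) :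
    IsDependencyGraph (tupleGraph ℓ G) (fun α ω => g α (kernelAt f X α ω)) P := by
  intro V₁ V₂ hV hadj
  have hind := hG {k | ∃ α ∈ V₁, ∃ i, α i = k} {k | ∃ α ∈ V₂, ∃ i, α i = k} ?_ ?_
  · let φ : ∀ V : Set (DistinctTuple n ℓ), ({k | ∃ α ∈ V, ∃ i, α i = k} → S) → V → ℝ :=
      fun V x α => g α (f fun i => x ⟨α.1 i, α.1, α.2, i, rfl⟩)
    have hφ : ∀ V, Measurable (φ V) := fun V => measurable_pi_lambda _ fun α =>
      (hg α).comp (hf.comp (measurable_pi_lambda _ fun i => measurable_pi_apply _))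
    exact hind.comp (hφ V₁) (hφ V₂)
  · rw [Set.disjoint_left]
    rintro k ⟨α, hα, i, hi⟩ ⟨β, hβ, j, hj⟩
    exact hadj α hα β hβ ⟨fun h => Set.disjoint_left.1 hV hα (h ▸ hβ), i, j,
      Or.inl (hi.trans hj.symm)⟩
  · rintro _ ⟨α, hα, i, rfl⟩ _ ⟨β, hβ, j, rfl⟩ h
    exact hadj α hα β hβ ⟨fun h => Set.disjoint_left.1 hV hα (h ▸ hβ), i, j, Or.inr h⟩

lemma card_closedNbhd_le_maxDegree_add_one (G : SimpleGraph (Fin n)) [DecidableRel G.Adj]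
    (k : Fin n) : (closedNbhd G k).card ≤ G.maxDegree + 1 := by
  have : closedNbhd G k ⊆ insert k (G.neighborFinset k) := fun j hj => by
    rw [Finset.mem_insert, SimpleGraph.mem_neighborFinset]
    exact mem_closedNbhd.1 hj
  refine (Finset.card_le_card this).trans ((Finset.card_insert_le _ _).trans ?_)
  exact Nat.succ_le_succ (G.degree_le_maxDegree k)

lemma card_tuples_through_le (j : Fin ℓ) (v : Fin n) :
    (Finset.univ.filter fun β : DistinctTuple n ℓ => β j = v).card ≤ n ^ (ℓ - 1) := by
  have hcard : (Finset.univ : Finset ({k : Fin ℓ // k ≠ j} → Fin n)).card = n ^ (ℓ - 1) := by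
    simp
  rw [← hcard]
  refine Finset.card_le_card_of_injOn (fun β k => β k) (fun _ _ => Finset.mem_univ _) ?_
  intro β hβ γ hγ h
  simp only [Finset.coe_filter, Finset.mem_univ, true_and, Set.mem_ofPred_eq] at hβ hγ
  ext k
  by_cases hk : k = j
  · rw [hk, hβ, hγ]
  · exact congrArg Fin.val (congrFun h ⟨k, hk⟩)

lemma card_closedNbhd_tupleGraph_le (hℓ : 1 ≤ ℓ) {m : ℕ} (G : SimpleGraph (Fin n))
    [DecidableRel G.Adj] (hdeg : G.maxDegree ≤ m) (α : DistinctTuple n ℓ) :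
    (closedNbhd (tupleGraph ℓ G) α).card ≤ ℓ ^ 2 * (m + 1) * n ^ (ℓ - 1) := by
  classical
  have hsub : closedNbhd (tupleGraph ℓ G) α ⊆
      (Finset.univ : Finset (Fin ℓ × Fin ℓ)).biUnion fun p =>
        (closedNbhd G (α p.1)).biUnion fun v =>
          Finset.univ.filter fun β : DistinctTuple n ℓ => β p.2 = v := fun β hβ => by
    have : ∃ i j, β j ∈ closedNbhd G (α i) := by
      rcases mem_closedNbhd.1 hβ with rfl | ⟨_, i, j, h⟩
      · exact ⟨⟨0, hℓ⟩, ⟨0, hℓ⟩, mem_closedNbhd.2 (Or.inl rfl)⟩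
      · exact ⟨i, j, mem_closedNbhd.2 (h.imp Eq.symm id)⟩
    obtain ⟨i, j, h⟩ := this
    simp only [Finset.mem_biUnion, Finset.mem_univ, true_and, Finset.mem_filter]
    exact ⟨(i, j), β j, h, rfl⟩
  refine (Finset.card_le_card hsub).trans ((Finset.card_biUnion_le_card_mul _ _
    ((m + 1) * n ^ (ℓ - 1)) fun p _ => ?_).trans_eq ?_)
  · refine (Finset.card_biUnion_le_card_mul _ _ (n ^ (ℓ - 1)) fun v _ =>
      card_tuples_through_le p.2 v).trans (Nat.mul_le_mul_right _ ?_)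
    exact (card_closedNbhd_le_maxDegree_add_one G _).trans (Nat.succ_le_succ hdeg)
  · simp only [Finset.card_univ, Fintype.card_prod, Fintype.card_fin]
    ring

end Tuples

/-! ### Normal approximation of U-statistics -/

lemma ae_abs_kernelAt_sub_le {Ω S : Type*} [MeasurableSpace Ω] {P : Measure Ω} {n ℓ : ℕ}
    {f : (Fin ℓ → S) → ℝ} {X : Fin n → Ω → S} {c : DistinctTuple n ℓ → ℝ} {L : ℝ} (hL : 0 ≤ L)
    (h : kernelMaxNorm f X c P ≤ ENNReal.ofReal L) (α : DistinctTuple n ℓ) :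
    ∀ᵐ ω ∂P, |kernelAt f X α ω - c α| ≤ L := by
  have h1 : eLpNorm (fun ω => kernelAt f X α ω - c α) ∞ P ≤ ENNReal.ofReal L :=
    (le_iSup (fun α => eLpNorm (fun ω => kernelAt f X α ω - c α) ∞ P) α).trans h
  rw [eLpNorm_exponent_top] at h1
  filter_upwards [enorm_ae_le_eLpNormEssSup (fun ω => kernelAt f X α ω - c α) P] with ω hω
  have h2 := hω.trans h1
  rwa [Real.enorm_eq_ofReal_abs, ENNReal.ofReal_le_ofReal_iff hL] at h2

lemma ae_abs_sub_integral_le {Ω : Type*} [MeasurableSpace Ω] {P : Measure Ω}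
    [IsProbabilityMeasure P] {Z : Ω → ℝ} (hm : Measurable Z) {a C : ℝ}
    (hb : ∀ᵐ ω ∂P, |Z ω - a| ≤ C) : ∀ᵐ ω ∂P, |Z ω - ∫ ω', Z ω' ∂P| ≤ 2 * C := by
  have hi : Integrable Z P := (memLp_of_abs_sub_le hm hb 1).integrable le_rfl
  have h1 : |∫ ω', Z ω' ∂P - a| ≤ C := by
    have e : ∫ ω', Z ω' ∂P - a = ∫ ω', (Z ω' - a) ∂P := by
      rw [integral_sub hi (integrable_const a)]; simp
    rw [e]
    have := norm_integral_le_of_norm_le_const (μ := P) (f := fun ω' => Z ω' - a) hb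
    simpa using this
  filter_upwards [hb] with ω h
  have := abs_sub_le (Z ω) a (∫ ω', Z ω' ∂P)
  rw [abs_sub_comm a] at this
  linarith

theorem mainTheorem7 {Ω S : Type*} [MeasurableSpace Ω] [MeasurableSpace S]
    (P : Measure Ω) [IsProbabilityMeasure P]
    (n m ℓ : ℕ) (hℓ : 1 ≤ ℓ)
    (X : Fin n → Ω → S) (hX : ∀ k, Measurable (X k))
    (G : SimpleGraph (Fin n)) [DecidableRel G.Adj]
    (hG : IsDependencyGraph G X P) (hdeg : G.maxDegree ≤ m)
    (c : DistinctTuple n ℓ → ℝ)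
    (f : (Fin ℓ → S) → ℝ) (hf : Measurable f)
    (L : ℝ) (hL : 0 < L) (hmax : kernelMaxNorm f X c P = ENNReal.ofReal L)
    (hvar : variance (uStat f X) P ≠ 0) :
    xiInfty f X m L P ∈ Set.Ioc (0 : ℝ) 1 ∧
    kolmogorovDist
        (P.map fun ω => (uStat f X ω - ∫ ω', uStat f X ω' ∂P) / √(variance (uStat f X) P))
        (gaussianReal 0 1)
      ≤ 227.5 * √((ℓ : ℝ) ^ 2 * ((m : ℝ) + 1) / (n : ℝ)) * (xiInfty f X m L P) ^ (-3 : ℤ) := by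
  classical
  set a : ℝ := (ℓ.factorial : ℝ) * (n.choose ℓ : ℝ) with ha
  -- If `n < ℓ` there are no tuples, and the U-statistic vanishes.
  have hle : ℓ ≤ n := by
    by_contra! hlt
    refine hvar ?_
    have : uStat f X = (0 : Ω → ℝ) := by
      funext ω
      simp [uStat, Nat.choose_eq_zero_of_lt hlt]
    rw [this, variance_zero]
  have ha0 : 0 < a := mul_pos (by exact_mod_cast ℓ.factorial_pos)
    (by exact_mod_cast Nat.choose_pos hle)
  have hn0 : 0 < (n : ℝ) := by exact_mod_cast hℓ.trans hle
  have hℓ0 : 0 < (ℓ : ℝ) := by exact_mod_cast hℓ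
  set Y : DistinctTuple n ℓ → Ω → ℝ := kernelAt f X with hY
  have hYm : ∀ α, Measurable (Y α) := fun α =>
    hf.comp (measurable_pi_lambda _ fun i => hX (α i))
  have hYb := ae_abs_kernelAt_sub_le hL.le hmax.le
  have hYi : ∀ α, Integrable (Y α) P := fun α =>
    (memLp_of_abs_sub_le (hYm α) (hYb α) 1).integrable le_rfl
  have hV : vStat f X = fun ω => ∑ α, Y α ω := by
    funext ω
    simp only [vStat, uStat]
    rw [← ha]
    field_simp
    rfl
  have hU : uStat f X = fun ω => a⁻¹ * vStat f X ω := by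
    funext ω
    simp only [vStat]
    rw [← ha, inv_mul_cancel_left₀ ha0.ne']
  set v := variance (vStat f X) P with hv
  have hUv : variance (uStat f X) P = a⁻¹ ^ 2 * v := by rw [hU, variance_const_mul]
  have hv0 : 0 < v :=
    lt_of_le_of_ne (variance_nonneg _ _) fun h => hvar (by rw [hUv, ← h, mul_zero])
  set σ := √v with hσ
  have hσ0 : 0 < σ := Real.sqrt_pos.2 hv0
  have hσsq : σ ^ 2 = v := Real.sq_sqrt hv0.le
  set b : ℝ := (ℓ : ℝ) ^ 2 * ((m : ℝ) + 1) with hb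
  have hb0 : 0 < b := by positivity
  set D : ℕ := ℓ ^ 2 * (m + 1) * n ^ (ℓ - 1) with hD
  have hDb : (D : ℝ) = b * n ^ (ℓ - 1) := by rw [hD, hb]; push_cast; ring
  set Q : ℝ := b * (n : ℝ) ^ (2 * ℓ - 1) with hQ
  have hQ0 : 0 < Q := by positivity
  have hQD : Q = n ^ ℓ * D := by
    rw [hQ, hDb, show 2 * ℓ - 1 = ℓ + (ℓ - 1) by omega, pow_add]; ring
  have hcard : (Fintype.card (DistinctTuple n ℓ) : ℝ) ≤ n ^ ℓ := by
    have : Fintype.card (DistinctTuple n ℓ) ≤ n ^ ℓ := by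
      rw [Fintype.card_embedding_eq, Fintype.card_fin, Fintype.card_fin]
      exact Nat.descFactorial_le_pow n ℓ
    exact_mod_cast this
  have hnbhd : ∀ α, (closedNbhd (tupleGraph ℓ G) α).card ≤ D :=
    card_closedNbhd_tupleGraph_le hℓ G hdeg
  have hxi : xiInfty f X m L P = σ / (L * √Q) := by
    rw [xiInfty, ← hv, ← hb, ← hQ, Real.sqrt_div hv0.le]
    field_simp
    rfl
  have hvQ : v ≤ Q * L ^ 2 := by
    have hdep := isDependencyGraph_tupleGraph (ℓ := ℓ) hG hf (g := fun _ x => x)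
      fun _ => measurable_id
    have hmem : ∀ α, MemLp (Y α) 2 P := fun α => memLp_of_abs_sub_le (hYm α) (hYb α) 2
    have key := variance_sum_le_of_card_correlated_le (P := P) Finset.univ Y hYm c hYb
      (fun α β => β ∈ closedNbhd (tupleGraph ℓ G) α)
      (fun α _ β _ h => by
        have := hdep.indepFun_comp {α} {β} (fun i hi j hj => by
            rwa [Set.mem_singleton_iff.1 hi, Set.mem_singleton_iff.1 hj])
          (measurable_pi_apply ⟨α, rfl⟩) (measurable_pi_apply ⟨β, rfl⟩)
        exact this.covariance_eq_zero (hmem α) (hmem β))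
      (K := D) (fun α _ => by
        rw [Finset.filter_mem_eq_inter, Finset.univ_inter]
        exact hnbhd α)
    rw [hv, hV, hQD, mul_assoc]
    exact key.trans (mul_le_mul_of_nonneg_right (by simpa using hcard) (by positivity))
  refine ⟨⟨by rw [hxi]; positivity, ?_⟩, ?_⟩
  · rw [hxi, div_le_one (by positivity), hσ]
    refine Real.sqrt_le_iff.2 ⟨by positivity, ?_⟩
    rw [mul_pow, Real.sq_sqrt hQ0.le]
    linarith
  · set e : DistinctTuple n ℓ → ℝ := fun α => ∫ ω, Y α ω ∂P with he
    set ξ : DistinctTuple n ℓ → Ω → ℝ := fun α ω => (Y α ω - e α) / σ with hξ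
    have hξm : ∀ α, Measurable (ξ α) := fun α => ((hYm α).sub_const _).div_const _
    have hdep : IsDependencyGraph (tupleGraph ℓ G) ξ P :=
      isDependencyGraph_tupleGraph hG hf (g := fun α x => (x - e α) / σ)
        fun α => (measurable_id.sub_const _).div_const _
    have hξB : ∀ α, ∀ᵐ ω ∂P, |ξ α ω| ≤ 2 * L / σ := fun α => by
      filter_upwards [ae_abs_sub_integral_le (hYm α) (hYb α)] with ω h
      rw [hξ]
      simp only
      rw [abs_div, abs_of_pos hσ0]
      exact div_le_div_of_nonneg_right h hσ0.le
    have hξ0 : ∀ α, ∫ ω, ξ α ω ∂P = 0 := fun α => by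
      rw [hξ]
      simp only
      rw [integral_div, integral_sub (hYi α) (integrable_const _)]
      simp [he]
    have hEV : ∫ ω, vStat f X ω ∂P = ∑ α, e α := by
      rw [hV, integral_finsetSum _ fun α _ => hYi α]
    have hsum : ∀ ω, ∑ α, ξ α ω = (vStat f X ω - ∫ ω', vStat f X ω' ∂P) / σ := fun ω => by
      rw [hEV, hV, hξ, ← Finset.sum_sub_distrib, Finset.sum_div]
    have hVm : Measurable (vStat f X) := by
      rw [hV]; exact Finset.measurable_sum _ fun α _ => hYm α
    have hW : ∫ ω, (∑ α, ξ α ω) ^ 2 ∂P = 1 := by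
      simp_rw [hsum, div_pow]
      rw [integral_div, ← variance_eq_integral hVm.aemeasurable, ← hv, hσsq, div_self hv0.ne']
    have hstd : (fun ω => (uStat f X ω - ∫ ω', uStat f X ω' ∂P) / √(variance (uStat f X) P)) =
        fun ω => ∑ α, ξ α ω := by
      funext ω
      rw [hsum, hUv, Real.sqrt_mul (by positivity), Real.sqrt_sq (by positivity), hU,
        integral_const_mul, ← hσ, ← mul_sub, mul_div_mul_left _ _ (by positivity)]
    have hBE := kolmogorovDist_sum_le hdep hξm (by positivity) hξB hξ0 hnbhd hW
    rw [hstd]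
    refine hBE.trans ?_
    have hroot : √(b / n) * √Q = D := by
      rw [← Real.sqrt_mul (by positivity), hDb]
      have : b / n * Q = (b * (n : ℝ) ^ (ℓ - 1)) ^ 2 := by
        rw [hQ, show 2 * ℓ - 1 = (ℓ - 1) * 2 + 1 by omega, pow_succ, pow_mul]
        field_simp
      rw [this, Real.sqrt_sq (by positivity)]
    have hQs : √Q ^ 2 = n ^ ℓ * D := by rw [Real.sq_sqrt hQ0.le, hQD]
    have hrhs : √(b / n) * xiInfty f X m L P ^ (-3 : ℤ) = n ^ ℓ * D ^ 2 * (L / σ) ^ 3 := by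
      rw [hxi, zpow_neg, ← inv_zpow, inv_div]
      calc √(b / n) * (L * √Q / σ) ^ (3 : ℤ)
          = (√(b / n) * √Q) * √Q ^ 2 * (L / σ) ^ 3 := by
            rw [show (3 : ℤ) = ((3 : ℕ) : ℤ) by rfl, zpow_natCast]; ring
        _ = n ^ ℓ * D ^ 2 * (L / σ) ^ 3 := by rw [hroot, hQs]; ring
    rw [mul_assoc (227.5 : ℝ), hrhs]
    calc 47 / 2 * (Fintype.card (DistinctTuple n ℓ) * (D : ℝ) ^ 2 * (2 * L / σ) ^ 3)
        = 188 * (Fintype.card (DistinctTuple n ℓ) * (D : ℝ) ^ 2 * (L / σ) ^ 3) := by ring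
      _ ≤ 227.5 * (n ^ ℓ * D ^ 2 * (L / σ) ^ 3) := by
        gcongr
        norm_num
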